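/- Let $M$ products have unit prices $p_i$, unit costs $c_i$ with $0<c_i<p_i$, and mean demands $\mu_i\ge 0$, $i\in[M]$; let $K\ge 0$ and $\alpha\ge 0$. Write $\pi_i(q,u)=p_i\min\{q,u\}-c_iq$. Let $\mathcal P_M$ be the set of probability distributions on $\mathbb R_+^M$, $\mathcal P=\mathcal P_1$, and let $d_{\rm OT}(F,G)$ be the optimal-transport cost, i.e. the infimum of $\int\|u-v\|_2^2\,d\Gamma(u,v)$ over all couplings $\Gamma$ of $F$ and $G$. Let $$\mathcal C=\Big\{G\in\mathcal P_M \;\Big|\; \mathbb E_G[\tilde v_i]=\mu_i\ \forall i\in[M],\ \ \mathbb E_G\Big[\sum_{i\in[M]}\tilde v_i^2\Big]\le K\Big\},\qquad d(F,\mathcal C)=\inf_{G\in\mathcal C}d_{\rm OT}(F,G),$$ and consider the multi-product misspecification-averse newsvendor problem $$\max_{q\ge 0}\ \inf_{F\in\mathcal P_M}\Big\{\mathbb E_F\Big[\sum_{i\in[M]}\pi_i(q_i,\tilde u_i)\Big]+\alpha\, d(F,\mathcal C)\Big\}.\qquad(1)$$ Let $\lambda^\star$ be the optimal dual variable of the second-moment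 constraint, i.e. an optimal solution of $$\max_{\lambda\ge 0}\Big\{-\lambda K+\sum_{i\in[M]}\Pi_i(\lambda)\Big\},\quad \Pi_i(\lambda)=\sup_{q_i\ge 0}\inf_{F_i\in\mathcal P}\Big\{\mathbb E_{F_i}[\pi_i(q_i,\tilde u_i)]+\inf_{G_i\in\mathcal P:\,\mathbb E_{G_i}[\tilde v_i]=\mu_i}\big\{\lambda\,\mathbb E_{G_i}[\tilde v_i^2]+\alpha\, d_{\rm OT}(F_i,G_i)\big\}\Big\}.$$ If $K>\sum_{i\in[M]}\mu_i^2$, then $\lambda^\star$ exists and is unique. Moreover, for every $K \ge 0$, given an optimal $\lambda^\star$, problem (1) has a unique optimal order vector $q^\star_\alpha$, and for each $i\in[M]$ $$q^\star_{i,\alpha}=\mu_i+\frac{p_i-2c_i}{4\lambda^\star}-\frac{p_i}{4\alpha}\quad\text{if }\ \alpha\ge\frac{p_i}{2\big(\mu_i-c_i/(2\lambda^\star)\big)^+},$$ $$q^\star_{i,\alpha}=\frac{\lambda^\star(\lambda^\star+\alpha)\,p_i\,\mu_i^2}{\alpha\,(p_i\lambda^\star/\alpha+c_i)^2}\quad\text{otherwise},$$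 where $1/0=\infty$ in the condition (so it fails if $\lambda^\star=0$ or if the positive part is $0$), and the last expression is read as its limit $0$ when $\alpha=0$. -/

import Mathlib

open MeasureTheory
open scoped NNReal ENNReal

noncomputable section

namespace Newsvendor

/-- Profit `p * min q u - c * q` of one product: unit price `p`, unit cost `c`, order `q`,
realized demand `u ≥ 0`. -/
def profit (p c q : ℝ) (u : ℝ≥0) : ℝ := p * min q (u : ℝ) - c * q

/-- Optimal-transport cost between `F` and `G` for the ground cost `cost`: the infimum of the
expected cost over all joint probability distributions with marginals `F` and `G`. -/
def otCost {X : Type*} [MeasurableSpace X] (cost : X → X → ℝ≥0∞)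
    (F G : ProbabilityMeasure X) : ℝ≥0∞ :=
  ⨅ (Γ : ProbabilityMeasure (X × X))
    (_ : (Γ : Measure (X × X)).map Prod.fst = (F : Measure X))
    (_ : (Γ : Measure (X × X)).map Prod.snd = (G : Measure X)),
    ∫⁻ z, cost z.1 z.2 ∂(Γ : Measure (X × X))

/-- The quadratic cost `|u - v|²` on `ℝ₊`. -/
def sqCost (u v : ℝ≥0) : ℝ≥0∞ := ENNReal.ofReal (((u : ℝ) - (v : ℝ)) ^ 2)

/-- The squared Euclidean cost `‖u - v‖₂²` on `ℝ₊^M`. -/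
def sqCostVec {M : ℕ} (u v : Fin M → ℝ≥0) : ℝ≥0∞ := ∑ i, sqCost (u i) (v i)

/-- The ambiguity set of demand distributions on `ℝ₊^M` whose `i`-th mean is `μ i` and whose
second moments sum up to at most `K`. -/
def ambiguitySet {M : ℕ} (μ : Fin M → ℝ) (K : ℝ) : Set (ProbabilityMeasure (Fin M → ℝ≥0)) :=
  {G | (∀ i, ∫⁻ v, (v i : ℝ≥0∞) ∂(G : Measure (Fin M → ℝ≥0)) = ENNReal.ofReal (μ i)) ∧
    ∫⁻ v, ∑ i, (v i : ℝ≥0∞) ^ 2 ∂(G : Measure (Fin M → ℝ≥0)) ≤ ENNReal.ofReal K}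

/-- Distance `d(F, C)` of `F` to a set `C` of distributions: the least transport cost from `F` to
a member of `C`. -/
def distToSet {M : ℕ} (F : ProbabilityMeasure (Fin M → ℝ≥0))
    (C : Set (ProbabilityMeasure (Fin M → ℝ≥0))) : ℝ≥0∞ :=
  ⨅ G ∈ C, otCost sqCostVec F G

/-- The misspecification-averse criterion of the order vector `q`: the worst case over all demand
distributions `F` on `ℝ₊^M` of the expected total profit plus `α` times the distance of `F` to
the ambiguity set. The profit is a bounded function of the demand, so the expectation is finite. -/
def criterion {M : ℕ} (p c μ : Fin M → ℝ) (K α : ℝ) (q : Fin M → ℝ) : EReal :=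
  ⨅ F : ProbabilityMeasure (Fin M → ℝ≥0),
    ((∫ u, ∑ i, profit (p i) (c i) (q i) (u i) ∂(F : Measure (Fin M → ℝ≥0)) : ℝ) : EReal) +
      ((ENNReal.ofReal α * distToSet F (ambiguitySet μ K) : ℝ≥0∞) : EReal)

/-- `q` solves the multi-product misspecification-averse newsvendor problem: it is a non-negative
order vector that maximizes the criterion among all non-negative order vectors. -/
def IsOptimalOrder {M : ℕ} (p c μ : Fin M → ℝ) (K α : ℝ) (q : Fin M → ℝ) : Prop :=
  (∀ i, 0 ≤ q i) ∧
    ∀ q' : Fin M → ℝ, (∀ i, 0 ≤ q' i) → criterion p c μ K α q' ≤ criterion p c μ K α q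

/-- Distributions on `ℝ₊` with mean `μ`. -/
def meanSet (μ : ℝ) : Set (ProbabilityMeasure ℝ≥0) :=
  {G | ∫⁻ v, (v : ℝ≥0∞) ∂(G : Measure ℝ≥0) = ENNReal.ofReal μ}

/-- Optimal value of the single-product problem in which the second moment is priced at `lam`. -/
def singleValue (p c μ α lam : ℝ) : EReal :=
  ⨆ (q : ℝ) (_ : 0 ≤ q), ⨅ F : ProbabilityMeasure ℝ≥0,
    ((∫ u, profit p c q u ∂(F : Measure ℝ≥0) : ℝ) : EReal) +
      ((⨅ G ∈ meanSet μ,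
        (ENNReal.ofReal lam * ∫⁻ v, (v : ℝ≥0∞) ^ 2 ∂(G : Measure ℝ≥0) +
          ENNReal.ofReal α * otCost sqCost F G) : ℝ≥0∞) : EReal)

/-- Objective of the dual problem, in the multiplier `lam` of the second-moment constraint. -/
def dualObjective {M : ℕ} (p c μ : Fin M → ℝ) (K α lam : ℝ) : EReal :=
  ((-(lam * K) : ℝ) : EReal) + ∑ i, singleValue (p i) (c i) (μ i) α lam

/-- `lam` is an optimal dual variable. -/
def IsDualOptimal {M : ℕ} (p c μ : Fin M → ℝ) (K α lam : ℝ) : Prop :=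
  0 ≤ lam ∧ ∀ lam' : ℝ, 0 ≤ lam' → dualObjective p c μ K α lam' ≤ dualObjective p c μ K α lam

/-- The inequality `α ≥ p / (2 (μ - c / (2 lam))⁺)` under the convention `1 / 0 = ∞`: it fails
when `lam = 0` (as `c > 0`) and when the positive part vanishes (as `p > 0`). -/
def HighAlpha (p c μ α lam : ℝ) : Prop :=
  0 < lam ∧ 0 < μ - c / (2 * lam) ∧ p / (2 * (μ - c / (2 * lam))) ≤ α

open scoped Classical in
/-- The closed-form order quantity. For `α = 0` the second expression has the value `0` here
(division by zero), which is also its limit as `α` decreases to `0`. -/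
def orderQuantity (p c μ α lam : ℝ) : ℝ :=
  if HighAlpha p c μ α lam then
    μ + (p - 2 * c) / (4 * lam) - p / (4 * α)
  else
    lam * (lam + α) * p * μ ^ 2 / (α * (p * lam / α + c) ^ 2)

end Newsvendor

end

/-! The proof exhibits an explicit saddle point and needs no minimax theorem. Put θ = c/p. For a
fixed price λ of the second moment, nature's worst baseline law of one product puts weight 1-θ on x
and θ on y; misspecification moves x down to u and leaves y in place. `exists_worstCase` solves the
optimality conditions for u, x, y and Q = `orderQuantity`.

Lower bound at Q: the profit at s plus the costs α(s-t)² + λt² has an affine minorant in the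
baseline demand t (`exists_affine_minorant`). Integrated along a coupling, it depends on the
baseline law only through its mean.

Upper bound for every q: a one-parameter family of two-point laws with the same mean and variance as
the worst case contains a law whose value is at most that of Q, and strictly less if q ≠ Q
(`exists_twoPoint`). The second moment S(λ) of these laws does not depend on q.

Hence the value of one product at any price λ' is at most V(λ) + λ'S(λ), with equality at λ' = λ.
Summed over products, this makes ∑S(λ) - K a supergradient of the dual objective. With continuity of
S, dual optimality becomes ∑S(λ) ≤ K with equality when λ > 0 (`isDualOptimal_iff`). Monotonicity of
S yields existence and uniqueness. At an optimal λ the two-point laws are feasible for (1) and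
complementary slackness closes the gap, so the strict bound identifies the only optimal order. -/

namespace Newsvendor

/-! ### Closed forms and optimality conditions for one product -/

/-- Difference between the two values taken by the baseline demand in the worst case, when the
second moment has the price `lam`. -/
noncomputable def demandGap (p c μ α lam : ℝ) : ℝ :=
  p * α * μ / max (p * lam + α * c) (2 * α * μ * lam)

/-- Second moment of the baseline demand in the worst case. -/
noncomputable def worstSecondMoment (p c μ α lam : ℝ) : ℝ :=
  μ ^ 2 + c / p * (1 - c / p) * demandGap p c μ α lam ^ 2

/-- Worst-case expected profit plus misspecification cost of the optimal order. -/
noncomputable def worstValue (p c μ α lam : ℝ) : ℝ :=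
  (1 - c / p) * (p * orderQuantity p c μ α lam - lam * demandGap p c μ α lam ^ 2)

variable {p c μ α lam : ℝ}

lemma demandGap_nonneg (hc : 0 < c) (hcp : c < p) (hμ : 0 ≤ μ) (hα : 0 ≤ α) (hl : 0 ≤ lam) :
    0 ≤ demandGap p c μ α lam := by
  have hp : 0 < p := hc.trans hcp
  exact div_nonneg (by positivity) (le_max_of_le_left (by positivity))

/-- Clearing denominators shows that the case distinction of the order quantity is the question
which argument of the `max` in `demandGap` is larger. -/
lemma highAlpha_iff (hc : 0 < c) (hp : 0 < p) (hα : 0 < α) (hl : 0 ≤ lam) :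
    HighAlpha p c μ α lam ↔ p * lam + α * c ≤ 2 * α * μ * lam := by
  unfold HighAlpha
  constructor
  · rintro ⟨h1, h2, h3⟩
    rw [div_le_iff₀ (by positivity)] at h3
    have : α * (2 * (μ - c / (2 * lam))) * lam = 2 * α * μ * lam - α * c := by
      field_simp
    nlinarith
  · intro h
    have hl' : 0 < lam := by
      rcases hl.eq_or_lt with h0 | h0
      · subst h0; nlinarith [mul_pos hα hc]
      · exact h0
    have e : α * (2 * (μ - c / (2 * lam))) * lam = 2 * α * μ * lam - α * c := by
      field_simp
    have e2 : p ≤ α * (2 * (μ - c / (2 * lam))) := by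
      by_contra! hh
      nlinarith
    have e3 : 0 < μ - c / (2 * lam) := by
      by_contra! hh
      nlinarith
    exact ⟨hl', e3, by rw [div_le_iff₀ (by positivity)]; exact e2⟩

/-- These are the tangency conditions for an affine function of the baseline demand, of slope 2λy,
to touch the lower envelope at x and y. Equal slopes give α(x - u) = λ(y - x); optimality of u ≥ 0
gives the next two relations, by complementary slackness; equal intercepts give the formula for the
order. -/
lemma exists_worstCase (hc : 0 < c) (hcp : c < p) (hμ : 0 ≤ μ) (hα : 0 ≤ α) (hl : 0 ≤ lam) :
    ∃ u x y : ℝ, 0 ≤ u ∧ 0 ≤ x ∧ 0 ≤ y ∧ y - x = demandGap p c μ α lam ∧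
      (1 - c / p) * x + c / p * y = μ ∧ α * (x - u) = lam * (y - x) ∧ 2 * lam * (y - x) ≤ p ∧
      u * (p - 2 * lam * (y - x)) = 0 ∧
      p * orderQuantity p c μ α lam = p * u + α * (x - u) ^ 2 + lam * (y - x) ^ 2 := by
  have hp : 0 < p := hc.trans hcp
  rcases hα.eq_or_lt with h0 | hα'
  · subst h0
    refine ⟨0, μ, μ, le_rfl, hμ, hμ, by simp [demandGap], by ring, by simp, by simpa using hp.le,
      by simp, ?_⟩
    -- For α = 0 the worst case is u = 0, x = y = μ, and the order is 0 through division by zero.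
    have : ¬ HighAlpha p c μ 0 lam := by
      rintro ⟨h1, h2, h3⟩
      have : 0 < p / (2 * (μ - c / (2 * lam))) := by positivity
      linarith
    simp [orderQuantity, this]
  set m := max (p * lam + α * c) (2 * α * μ * lam) with hm
  have hm1 : p * lam + α * c ≤ m := le_max_left _ _
  have hm2 : 2 * α * μ * lam ≤ m := le_max_right _ _
  have hm0 : 0 < m := lt_of_lt_of_le (by positivity) hm1
  set d := demandGap p c μ α lam with hd
  have hdm : d * m = p * α * μ := by
    rw [hd, demandGap, ← hm]; field_simp
  have hd0 : 0 ≤ d := demandGap_nonneg hc hcp hμ hα hl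
  have hu : 0 ≤ μ - c / p * d - lam * d / α := by
    have e : (μ - c / p * d - lam * d / α) * (p * α) = d * (m - (p * lam + α * c)) := by
      rw [mul_sub, hdm]; field_simp; ring
    have : 0 ≤ (μ - c / p * d - lam * d / α) * (p * α) := by
      rw [e]; exact mul_nonneg hd0 (by linarith)
    exact nonneg_of_mul_nonneg_left this (by positivity)
  have hla : 0 ≤ lam * d / α := by positivity
  have hx : 0 ≤ μ - c / p * d := by linarith
  have h2 : 2 * lam * d ≤ p := by
    have : 2 * lam * d * m ≤ p * m := by
      have : 2 * lam * d * m = p * (2 * α * μ * lam) := by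
        rw [mul_assoc (2 * lam), hdm]; ring
      rw [this]; exact mul_le_mul_of_nonneg_left hm2 hp.le
    exact le_of_mul_le_mul_right this hm0
  refine ⟨μ - c / p * d - lam * d / α, μ - c / p * d, μ - c / p * d + d, hu, hx, by linarith,
    by ring, by field_simp; ring, ?_, by simpa using h2, ?_, ?_⟩
  · field_simp; ring
  · simp only [add_sub_cancel_left]
    -- The first argument of the `max` corresponds to u = 0, the second to 2λ(y - x) = p.
    rcases max_choice (p * lam + α * c) (2 * α * μ * lam) with h | h
    · rw [← hm] at h
      have e : (μ - c / p * d - lam * d / α) * (p * α) = d * (m - (p * lam + α * c)) := by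
        rw [mul_sub, hdm]; field_simp; ring
      rw [h, sub_self, mul_zero] at e
      rw [(mul_eq_zero.mp e).resolve_right (by positivity), zero_mul]
    · rw [← hm] at h
      have : (p - 2 * lam * d) * m = 0 := by
        have : (p - 2 * lam * d) * m = p * m - 2 * lam * (d * m) := by ring
        rw [this, hdm, h]; ring
      rw [(mul_eq_zero.mp this).resolve_right hm0.ne', mul_zero]
  · simp only [add_sub_cancel_left]
    unfold orderQuantity
    split_ifs with h
    · have hl' := h.1
      rw [highAlpha_iff hc hp hα' hl] at h
      have hμ' : 0 < μ := by
        rcases hμ.eq_or_lt with h0 | h0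
        · subst h0; nlinarith [mul_pos hα' hc, mul_pos hp hl']
        · exact h0
      have : d = p / (2 * lam) := by
        rw [hd, demandGap, max_eq_right h]; field_simp
      rw [this]; field_simp; ring
    · rw [highAlpha_iff hc hp hα' hl, not_le] at h
      have : d = p * α * μ / (p * lam + α * c) := by
        rw [hd, demandGap, max_eq_left h.le]
      rw [this]
      have h1 : p * lam + α * c ≠ 0 := by positivity
      have h2 : p * lam / α + c ≠ 0 := by positivity
      field_simp
      ring

lemma orderQuantity_nonneg (hc : 0 < c) (hcp : c < p) (hμ : 0 ≤ μ) (hα : 0 ≤ α) (hl : 0 ≤ lam) :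
    0 ≤ orderQuantity p c μ α lam := by
  obtain ⟨u, x, y, hu, -, -, -, -, -, -, -, h⟩ := exists_worstCase hc hcp hμ hα hl
  have hp : 0 < p := hc.trans hcp
  have : 0 ≤ p * orderQuantity p c μ α lam := by rw [h]; positivity
  exact nonneg_of_mul_nonneg_right this hp

/-- Affine minorant of the profit of the optimal order plus transport and moment costs. -/
lemma exists_affine_minorant (hc : 0 < c) (hcp : c < p) (hμ : 0 ≤ μ) (hα : 0 ≤ α)
    (hl : 0 ≤ lam) :
    ∃ a b : ℝ, a + b * μ =
        worstValue p c μ α lam + lam * worstSecondMoment p c μ α lam ∧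
      ∀ s t : ℝ≥0, a + b * t ≤
        profit p c (orderQuantity p c μ α lam) s + α * ((s : ℝ) - t) ^ 2 + lam * (t : ℝ) ^ 2 := by
  obtain ⟨u, x, y, hu, hx, hy, hd, hmean, hfoc, hle, hcs, hq⟩ :=
    exists_worstCase hc hcp hμ hα hl
  have hp : 0 < p := hc.trans hcp
  set q := orderQuantity p c μ α lam with hqd
  -- This is the tangent at t = y to the branch p q - c q + λt² of full sales.
  refine ⟨p * q - lam * y ^ 2 - c * q, 2 * lam * y, ?_, ?_⟩
  · rw [worstValue, worstSecondMoment, ← hd, ← hqd]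
    have e : c * q = c / p * (p * q) := by field_simp
    rw [e, ← hmean]; ring
  · intro s t
    have hs : (0 : ℝ) ≤ s := s.2
    unfold profit
    -- If sales equal q, the excess is α(s - t)² + λ(t - y)². If they equal s, it is α((s - u) - (t
    -- - x))² + λ(t - x)² + s(p - 2λ(y - x)).
    rcases min_choice q (s : ℝ) with h | h
    · rw [h]
      have h1 : 0 ≤ α * ((s : ℝ) - t) ^ 2 := by positivity
      have h2 : 0 ≤ lam * ((t : ℝ) - y) ^ 2 := by positivity
      linarith
    · rw [h, hq]
      have h1 : 0 ≤ α * (((s : ℝ) - u) - (t - x)) ^ 2 := by positivity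
      have h2 : 0 ≤ lam * ((t : ℝ) - x) ^ 2 := by positivity
      have h3 : 0 ≤ (s : ℝ) * (p - 2 * lam * (y - x)) := mul_nonneg hs (by linarith)
      have h4 : α * (x - u) * (2 * ((s : ℝ) - t - (u - x))) =
        lam * (y - x) * (2 * ((s : ℝ) - t - (u - x))) := by rw [hfoc]
      linarith

/-! ### Two-point laws that penalize a wrong order -/

lemma exists_small_neg {a b ε₀ : ℝ} (ha : 0 < a) (hε : 0 < ε₀) :
    ∃ ε, 0 < ε ∧ ε < ε₀ ∧ b * ε ^ 2 < a * ε := by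
  refine ⟨min (ε₀ / 2) (a / (2 * (|b| + 1))), by positivity,
    (min_le_left _ _).trans_lt (by linarith), ?_⟩
  set ε := min (ε₀ / 2) (a / (2 * (|b| + 1)))
  have h0 : 0 < ε := by positivity
  have h1 : ε * (2 * (|b| + 1)) ≤ a := by
    rw [← le_div_iff₀ (by positivity)]; exact min_le_right _ _
  have h2 : b * ε < a := by
    nlinarith [le_abs_self b, abs_nonneg b]
  nlinarith

/-- Two-point laws with mean `μ` and variance `θ * (1 - θ) * d ^ 2`, parametrized by `τ > 0`. -/
lemma twoPoint_moments {θ τ d : ℝ} (hτ : 0 < τ) (hN : 0 < 1 - θ + θ * τ ^ 2) :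
    (1 - θ) / (1 - θ + θ * τ ^ 2) * (μ - θ * d * τ) +
        (1 - (1 - θ) / (1 - θ + θ * τ ^ 2)) * (μ + (1 - θ) * d / τ) = μ ∧
      (1 - θ) / (1 - θ + θ * τ ^ 2) * (μ - θ * d * τ) ^ 2 +
        (1 - (1 - θ) / (1 - θ + θ * τ ^ 2)) * (μ + (1 - θ) * d / τ) ^ 2 =
        μ ^ 2 + θ * (1 - θ) * d ^ 2 := by
  have hN' := hN.ne'
  have e : 1 - (1 - θ) / (1 - θ + θ * τ ^ 2) = θ * τ ^ 2 / (1 - θ + θ * τ ^ 2) := by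
    field_simp; ring
  rw [e]
  constructor
  · field_simp; ring
  · field_simp; ring

/-- Improvement of the two-point law by a change of `τ` from the value `1`, if the slope `e * s` of
the objective `P` there is not zero. -/
lemma exists_perturbation {P : ℝ → ℝ} {e s g h μ : ℝ} (he : 0 < e) (hs : s ≠ 0) (hg : 0 ≤ g)
    (hx : 0 ≤ μ - g) (hx' : s < 0 → 0 < μ - g)
    (hP : ∀ ε, P (1 + ε) = e * s * ε + h * ε ^ 2) :
    ∃ τ, 0 < τ ∧ 0 ≤ μ - g * τ ∧ P τ < 0 := by
  rcases lt_or_gt_of_ne hs with hs' | hs'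
  · have := hx' hs'
    -- The bound (μ - g)/(g + 1) on ε keeps the lower atom μ - g(1 + ε) nonnegative.
    obtain ⟨ε, h1, h2, h3⟩ := exists_small_neg (a := e * -s) (b := h) (ε₀ := (μ - g) / (g + 1))
      (mul_pos he (by linarith)) (by positivity)
    rw [lt_div_iff₀ (by positivity)] at h2
    exact ⟨1 + ε, by linarith, by linarith, by rw [hP]; linarith⟩
  · obtain ⟨ε, h1, h2, h3⟩ := exists_small_neg (a := e * s) (b := h) (ε₀ := 1)
      (mul_pos he hs') one_pos
    have : 0 ≤ g * ε := by positivity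
    refine ⟨1 + -ε, by linarith, by linarith, by rw [hP]; linarith⟩

/-- Moving τ away from 1 keeps mean and variance, and by `hfoc` and `hQ` the first-order effect on
nature's value is proportional to q - Q. So τ is raised if q < Q and lowered if q > Q. The
inequality is stated after multiplication by 1 - θ + θτ², the normalizing constant of the weights.
-/
lemma exists_improvement {θ u x y q Q : ℝ} (hp : 0 < p) (hθ0 : 0 < θ) (hθ1 : θ < 1)
    (hα : 0 ≤ α) (hl : 0 ≤ lam) (hu : 0 ≤ u) (hx : 0 ≤ x) (hd : 0 ≤ y - x)
    (hmean : (1 - θ) * x + θ * y = μ) (hfoc : α * (x - u) = lam * (y - x))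
    (hcs : u * (p - 2 * lam * (y - x)) = 0)
    (hQ : p * Q = p * u + α * (x - u) ^ 2 + lam * (y - x) ^ 2) (hq0 : 0 ≤ q) (hq : q ≠ Q) :
    ∃ τ : ℝ, 0 < τ ∧ 0 ≤ μ - θ * (y - x) * τ ∧
      (1 - θ) * (p * u + α * (u - (μ - θ * (y - x) * τ)) ^ 2) + θ * τ ^ 2 * (p * q)
        - (1 - θ + θ * τ ^ 2) * (θ * p * q) <
      (1 - θ + θ * τ ^ 2) * ((1 - θ) * (p * u + α * (u - x) ^ 2)) := by
  have hxe : x = μ - θ * (y - x) := by linarith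
  have h1θ : 0 < 1 - θ := by linarith
  have hpos : q - Q < 0 → 0 < μ - θ * (y - x) := by
    intro h
    rw [← hxe]
    -- If x = 0, then -αu = λy forces both sides to vanish, hence u = 0 and Q = 0, which contradicts
    -- 0 ≤ q < Q.
    refine lt_of_le_of_ne hx fun h0 => ?_
    subst h0
    have h1 : 0 ≤ α * u := by positivity
    have h2 : 0 ≤ lam * (y - 0) := mul_nonneg hl hd
    have h3 : lam * (y - 0) = 0 := by linarith
    have h4 : u = 0 := by
      rw [mul_assoc, h3] at hcs
      simpa [hp.ne'] using hcs
    have h5 : p * Q = 0 := by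
      rw [hQ, h4, sq (y - 0), ← mul_assoc, h3]; simp
    exact (mul_pos hp (show 0 < Q by linarith)).ne' h5
  have hexp : ∀ ε, (1 - θ) * (p * u + α * (u - (μ - θ * (y - x) * (1 + ε))) ^ 2)
      + θ * (1 + ε) ^ 2 * (p * q) - (1 - θ + θ * (1 + ε) ^ 2) * (θ * p * q) -
      (1 - θ + θ * (1 + ε) ^ 2) * ((1 - θ) * (p * u + α * (u - x) ^ 2)) =
      2 * θ * (1 - θ) * p * (q - Q) * ε +
      (1 - θ) * (α * (θ * (y - x)) ^ 2 + θ * (p * q - (p * u + α * (u - x) ^ 2))) * ε ^ 2 := by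
    intro ε
    have e1 : u - (μ - θ * (y - x) * (1 + ε)) = (u - x) + θ * (y - x) * ε := by linarith
    have e2 : 2 * θ * (1 - θ) * p * (q - Q) * ε =
      2 * θ * (1 - θ) * (p * q - p * Q) * ε := by ring
    rw [e1, e2, hQ]
    linear_combination (- 2 * (1 - θ) * θ * (y - x) * ε) * hfoc
  obtain ⟨τ, h1, h2, h3⟩ := exists_perturbation
    (P := fun τ => (1 - θ) * (p * u + α * (u - (μ - θ * (y - x) * τ)) ^ 2) + θ * τ ^ 2 * (p * q)
        - (1 - θ + θ * τ ^ 2) * (θ * p * q) -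
        (1 - θ + θ * τ ^ 2) * ((1 - θ) * (p * u + α * (u - x) ^ 2)))
    (by positivity : 0 < 2 * θ * (1 - θ) * p) (sub_ne_zero.2 hq)
    (by positivity : 0 ≤ θ * (y - x)) (by linarith) hpos hexp
  exact ⟨τ, h1, h2, sub_neg.1 h3⟩

/-- Two-point laws with the worst-case second moment. Weight `w` is put on the baseline demand `x`,
transported to `u`, and the rest on `y`. -/
lemma exists_twoPoint (hc : 0 < c) (hcp : c < p) (hμ : 0 ≤ μ) (hα : 0 ≤ α) (hl : 0 ≤ lam)
    {q : ℝ} (hq0 : 0 ≤ q) :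
    ∃ (w : ℝ) (u x y : ℝ≥0), 0 ≤ w ∧ w ≤ 1 ∧ w * x + (1 - w) * y = μ ∧
      w * (x : ℝ) ^ 2 + (1 - w) * (y : ℝ) ^ 2 = worstSecondMoment p c μ α lam ∧
      w * (p * u + α * ((u : ℝ) - x) ^ 2) + (1 - w) * (p * q) - c * q ≤
        worstValue p c μ α lam ∧
      (q ≠ orderQuantity p c μ α lam →
        w * (p * u + α * ((u : ℝ) - x) ^ 2) + (1 - w) * (p * q) - c * q <
          worstValue p c μ α lam) := by
  obtain ⟨u, x, y, hu, hx, hy, hd, hmean, hfoc, -, hcs, hq⟩ :=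
    exists_worstCase hc hcp hμ hα hl
  have hp : 0 < p := hc.trans hcp
  have hd0 : 0 ≤ y - x := by rw [hd]; exact demandGap_nonneg hc hcp hμ hα hl
  obtain ⟨θ, hθ⟩ : ∃ θ, θ = c / p := ⟨_, rfl⟩
  rw [← hθ] at hmean
  have hθ0 : 0 < θ := by rw [hθ]; positivity
  have hθ1 : θ < 1 := by rw [hθ]; exact (div_lt_one hp).2 hcp
  have hcθ : c = θ * p := by rw [hθ]; field_simp
  have hV : worstValue p c μ α lam = (1 - θ) * (p * u + α * (u - x) ^ 2) := by
    rw [worstValue, ← hd, hq, ← hθ]; ring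
  have hS : worstSecondMoment p c μ α lam = μ ^ 2 + θ * (1 - θ) * (y - x) ^ 2 := by
    rw [worstSecondMoment, ← hd, ← hθ]
  rw [hS, hV]
  clear hS hV
  generalize orderQuantity p c μ α lam = Q at hq ⊢
  clear hd hθ
  subst hcθ
  by_cases hqq : q = Q
  · lift u to ℝ≥0 using hu
    lift x to ℝ≥0 using hx
    lift y to ℝ≥0 using hy
    -- At q = Q the unperturbed law (τ = 1) attains the value.
    refine ⟨1 - θ, u, x, y, by linarith, by linarith, ?_, ?_, ?_,
      fun h => absurd hqq h⟩
    · linarith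
    · rw [← hmean]; ring
    · apply le_of_eq; ring
  obtain ⟨τ, hτ, hxτ, hlt⟩ :=
    exists_improvement hp hθ0 hθ1 hα hl hu hx hd0 hmean hfoc hcs hq hq0 hqq
  have hyτ : 0 ≤ μ + (1 - θ) * (y - x) / τ :=
    add_nonneg hμ (div_nonneg (mul_nonneg (by linarith) hd0) hτ.le)
  have h2 : 0 < θ * τ ^ 2 := mul_pos hθ0 (pow_pos hτ 2)
  have hN : 0 < 1 - θ + θ * τ ^ 2 := by linarith
  have hlt' : (1 - θ) / (1 - θ + θ * τ ^ 2) *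
      (p * u + α * (u - (μ - θ * (y - x) * τ)) ^ 2) +
      (1 - (1 - θ) / (1 - θ + θ * τ ^ 2)) * (p * q) - θ * p * q <
      (1 - θ) * (p * u + α * (u - x) ^ 2) := by
    refine lt_of_mul_lt_mul_left (lt_of_eq_of_lt ?_ hlt) hN.le
    have e : (1 - θ + θ * τ ^ 2) * ((1 - θ) / (1 - θ + θ * τ ^ 2)) = 1 - θ :=
      mul_div_cancel₀ _ hN.ne'
    linear_combination (p * u + α * (u - (μ - θ * (y - x) * τ)) ^ 2 - p * q) * e
  obtain ⟨m1, m2⟩ := twoPoint_moments (μ := μ) (d := y - x) hτ hN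
  exact ⟨(1 - θ) / (1 - θ + θ * τ ^ 2), ⟨u, hu⟩, ⟨_, hxτ⟩, ⟨_, hyτ⟩,
    div_nonneg (by linarith) hN.le, (div_le_one hN).2 (by linarith),
    m1, m2, hlt'.le, fun _ => hlt'⟩

/-! ### Dependence of the worst-case second moment on its price -/

lemma continuousOn_worstSecondMoment (hc : 0 < c) (hcp : c < p) (hα : 0 ≤ α) :
    ContinuousOn (worstSecondMoment p c μ α) (Set.Ici 0) := by
  have hp : 0 < p := hc.trans hcp
  rcases hα.eq_or_lt with h0 | hα'
  · subst h0
    have : worstSecondMoment p c μ 0 = fun _ => μ ^ 2 := by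
      ext; simp [worstSecondMoment, demandGap]
    rw [this]; exact continuousOn_const
  unfold worstSecondMoment demandGap
  have hne : ∀ lam ∈ Set.Ici (0 : ℝ), max (p * lam + α * c) (2 * α * μ * lam) ≠ 0 := by
    intro lam hlam
    have : (0 : ℝ) ≤ lam := hlam
    exact (lt_max_of_lt_left (by positivity)).ne'
  fun_prop (disch := assumption)

lemma worstSecondMoment_eq_sq (h : α * μ = 0) : worstSecondMoment p c μ α lam = μ ^ 2 := by
  simp [worstSecondMoment, demandGap, mul_assoc, h]

lemma worstSecondMoment_lt (hc : 0 < c) (hcp : c < p) (hμ : 0 ≤ μ) (hα : 0 ≤ α)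
    (hμα : α * μ ≠ 0) {lam₁ lam₂ : ℝ} (h0 : 0 ≤ lam₁) (hlt : lam₁ < lam₂) :
    worstSecondMoment p c μ α lam₂ < worstSecondMoment p c μ α lam₁ := by
  have hp : 0 < p := hc.trans hcp
  have hα' : 0 < α := lt_of_le_of_ne hα (left_ne_zero_of_mul hμα).symm
  have hμ' : 0 < μ := lt_of_le_of_ne hμ (right_ne_zero_of_mul hμα).symm
  have hgap : demandGap p c μ α lam₂ < demandGap p c μ α lam₁ := by
    unfold demandGap
    apply div_lt_div_of_pos_left (by positivity) (lt_max_of_lt_left (by positivity))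
    have := mul_pos hα' hμ'
    exact max_lt (lt_max_of_lt_left (by nlinarith)) (lt_max_of_lt_right (by nlinarith))
  have hθ : 0 < c / p * (1 - c / p) :=
    mul_pos (by positivity) (sub_pos.2 ((div_lt_one hp).2 hcp))
  have := demandGap_nonneg hc hcp hμ hα (h0.trans hlt.le)
  unfold worstSecondMoment
  have : demandGap p c μ α lam₂ ^ 2 < demandGap p c μ α lam₁ ^ 2 :=
    pow_lt_pow_left₀ hgap this two_ne_zero
  nlinarith

lemma worstSecondMoment_anti (hc : 0 < c) (hcp : c < p) (hμ : 0 ≤ μ) (hα : 0 ≤ α)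
    {lam₁ lam₂ : ℝ} (h0 : 0 ≤ lam₁) (hlt : lam₁ < lam₂) :
    worstSecondMoment p c μ α lam₂ ≤ worstSecondMoment p c μ α lam₁ := by
  by_cases h : α * μ = 0
  · rw [worstSecondMoment_eq_sq h, worstSecondMoment_eq_sq h]
  · exact (worstSecondMoment_lt hc hcp hμ hα h h0 hlt).le

lemma sq_le_worstSecondMoment (hc : 0 < c) (hcp : c < p) :
    μ ^ 2 ≤ worstSecondMoment p c μ α lam := by
  have hp : 0 < p := hc.trans hcp
  have hθ : 0 < c / p * (1 - c / p) :=
    mul_pos (by positivity) (sub_pos.2 ((div_lt_one hp).2 hcp))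
  unfold worstSecondMoment
  have := mul_nonneg hθ.le (sq_nonneg (demandGap p c μ α lam))
  linarith

open Filter Topology in
lemma tendsto_worstSecondMoment (hc : 0 < c) (hcp : c < p) :
    Tendsto (worstSecondMoment p c μ α) atTop (𝓝 (μ ^ 2)) := by
  have hp : 0 < p := hc.trans hcp
  have h : Tendsto (demandGap p c μ α) atTop (𝓝 0) := by
    refine Tendsto.div_atTop tendsto_const_nhds (tendsto_atTop_mono (fun l => le_max_left _ _) ?_)
    exact tendsto_atTop_add_const_right _ _ (tendsto_id.const_mul_atTop hp)
  unfold worstSecondMoment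
  simpa using (h.pow 2).const_mul (c / p * (1 - c / p)) |>.const_add (μ ^ 2)

end Newsvendor
namespace Newsvendor

/-! ### Weak duality and couplings for optimal transport -/

section Transport
variable {X : Type*} [MeasurableSpace X]

lemma coe_le_coe_add_of_ofReal_sub_le {D r : ℝ} {e : ℝ≥0∞} (h : ENNReal.ofReal (D - r) ≤ e) :
    (D : EReal) ≤ (r : EReal) + (e : EReal) := by
  induction e with
  | top => simp
  | coe e =>
    have h1 : D - r ≤ e := by
      rw [← ENNReal.ofReal_coe_nnreal] at h
      exact (ENNReal.ofReal_le_ofReal_iff e.coe_nonneg).1 h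
    have h2 : D ≤ r + e := by linarith
    change (D : EReal) ≤ (r : EReal) + ((e : ℝ) : EReal)
    rw [← EReal.coe_add]
    exact_mod_cast h2

lemma coe_add_le_coe_of_le_ofReal {D r E : ℝ} {e : ℝ≥0∞} (hE : 0 ≤ E) (h : e ≤ ENNReal.ofReal E)
    (hD : r + E ≤ D) : (r : EReal) + (e : EReal) ≤ D := by
  calc (r : EReal) + (e : EReal) ≤ (r : EReal) + (ENNReal.ofReal E : EReal) := by
        gcongr
        exact_mod_cast h
    _ = ((r + E : ℝ) : EReal) := by
        rw [EReal.coe_ennreal_ofReal, max_eq_left hE, EReal.coe_add]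
    _ ≤ D := by exact_mod_cast hD

lemma ofReal_integral_le_lintegral {ν : Measure X} {f : X → ℝ} {g : X → ℝ≥0∞}
    (hf : Integrable f ν) (h : ∀ x, ENNReal.ofReal (f x) ≤ g x) :
    ENNReal.ofReal (∫ x, f x ∂ν) ≤ ∫⁻ x, g x ∂ν := by
  calc ENNReal.ofReal (∫ x, f x ∂ν) ≤ ENNReal.ofReal (∫ x, max (f x) 0 ∂ν) :=
        ENNReal.ofReal_le_ofReal (integral_mono hf hf.pos_part fun x => le_max_left _ _)
    _ = ∫⁻ x, ENNReal.ofReal (max (f x) 0) ∂ν :=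
        ofReal_integral_eq_lintegral_ofReal hf.pos_part (.of_forall fun x => le_max_right _ _)
    _ ≤ ∫⁻ x, g x ∂ν := lintegral_mono fun x => by simpa using h x

/-- Weak duality for transport plans. -/
lemma ofReal_integral_sub_integral_le {cost : X → X → ℝ≥0∞}
    (hcost : Measurable fun z : X × X => cost z.1 z.2) {g : X → ℝ≥0∞} (hg : Measurable g)
    {F G : ProbabilityMeasure X} {a : ℝ≥0∞} (ha : a ≠ ∞) {b : ℝ≥0∞} {f ℓ : X → ℝ}
    (hf : Integrable f (F : Measure X)) (hℓ : Integrable ℓ (G : Measure X))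
    (h : ∀ s t, ENNReal.ofReal (ℓ t - f s) ≤ a * cost s t + b * g t) :
    ENNReal.ofReal (∫ t, ℓ t ∂(G : Measure X) - ∫ s, f s ∂(F : Measure X)) ≤
      b * ∫⁻ t, g t ∂(G : Measure X) + a * otCost cost F G := by
  have key : ∀ Γ : ProbabilityMeasure (X × X),
      (Γ : Measure (X × X)).map Prod.fst = (F : Measure X) →
      (Γ : Measure (X × X)).map Prod.snd = (G : Measure X) →
      ENNReal.ofReal (∫ t, ℓ t ∂(G : Measure X) - ∫ s, f s ∂(F : Measure X)) -
        b * ∫⁻ t, g t ∂(G : Measure X) ≤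
        a * ∫⁻ z, cost z.1 z.2 ∂(Γ : Measure (X × X)) := by
    intro Γ h1 h2
    rw [← h1] at hf
    rw [← h2] at hℓ
    rw [← h1, ← h2, integral_map measurable_snd.aemeasurable hℓ.aestronglyMeasurable,
      integral_map measurable_fst.aemeasurable hf.aestronglyMeasurable,
      lintegral_map hg measurable_snd]
    change ENNReal.ofReal (∫ z, (ℓ ∘ Prod.snd) z ∂(Γ : Measure (X × X)) -
      ∫ z, (f ∘ Prod.fst) z ∂(Γ : Measure (X × X))) - _ ≤ _
    rw [← integral_sub (hℓ.comp_measurable measurable_snd)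
      (hf.comp_measurable measurable_fst), tsub_le_iff_right,
      ← lintegral_const_mul _ hcost, ← lintegral_const_mul (f := fun z : X × X => g z.2) _ (hg.comp measurable_snd),
      ← lintegral_add_left (hcost.const_mul a)]
    exact ofReal_integral_le_lintegral ((hℓ.comp_measurable measurable_snd).sub
      (hf.comp_measurable measurable_fst)) fun z => h z.1 z.2
  rw [add_comm, ← tsub_le_iff_right]
  rcases eq_or_ne a 0 with rfl | ha0
  -- For a = 0 one cannot divide by a; a single coupling suffices, and the product law is one.
  · have := key (F.prod G) (by simp [ProbabilityMeasure.prod]) (by simp [ProbabilityMeasure.prod])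
    simpa using this
  · rw [mul_comm a]
    refine (ENNReal.div_le_iff_le_mul (.inl ha0) (.inl ha)).1 ?_
    exact le_iInf fun Γ => le_iInf fun h1 => le_iInf fun h2 =>
      ENNReal.div_le_of_le_mul' (key Γ h1 h2)

lemma otCost_map_le {Ω : Type*} [MeasurableSpace Ω] (ν : ProbabilityMeasure Ω)
    (cost : X → X → ℝ≥0∞) {U V : Ω → X} (hU : Measurable U) (hV : Measurable V) :
    otCost cost (ν.map hU.aemeasurable) (ν.map hV.aemeasurable) ≤
      ∫⁻ ω, cost (U ω) (V ω) ∂(ν : Measure Ω) := by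
  have hUV : Measurable fun ω => (U ω, V ω) := hU.prodMk hV
  refine (iInf_le _ (ν.map hUV.aemeasurable)).trans
    ((iInf_le _ ?_).trans ((iInf_le _ ?_).trans ?_))
  · simp only [ProbabilityMeasure.toMeasure_map]
    rw [Measure.map_map measurable_fst hUV]; rfl
  · simp only [ProbabilityMeasure.toMeasure_map]
    rw [Measure.map_map measurable_snd hUV]; rfl
  · simp only [ProbabilityMeasure.toMeasure_map]
    exact lintegral_map_le _ _

end Transport

/-! ### Two-point random variables on the unit interval -/

section Step

/-- The uniform distribution on `(0, 1]`. -/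
noncomputable def uniform01 : ProbabilityMeasure ℝ :=
  ⟨volume.restrict (Set.Ioc 0 1), ⟨by simp⟩⟩

/-- The random variable with value `a` with probability `w` and `b` otherwise. -/
noncomputable def step {X : Type*} (w : ℝ) (a b : X) (ω : ℝ) : X := if ω ≤ w then a else b

variable {X : Type*} [MeasurableSpace X]

@[fun_prop]
lemma measurable_step (w : ℝ) (a b : X) : Measurable (step w a b) :=
  Measurable.ite measurableSet_Iic measurable_const measurable_const

lemma uniform01_Iic {w : ℝ} (h1 : w ≤ 1) :
    (uniform01 : Measure ℝ) (Set.Iic w) = ENNReal.ofReal w := by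
  change volume.restrict (Set.Ioc 0 1) (Set.Iic w) = _
  rw [Measure.restrict_apply measurableSet_Iic, Set.inter_comm, Set.Ioc_inter_Iic,
    min_eq_right h1, Real.volume_Ioc, sub_zero]

lemma uniform01_Ioi {w : ℝ} (h0 : 0 ≤ w) :
    (uniform01 : Measure ℝ) (Set.Ioi w) = ENNReal.ofReal (1 - w) := by
  change volume.restrict (Set.Ioc 0 1) (Set.Ioi w) = _
  rw [Measure.restrict_apply measurableSet_Ioi, Set.inter_comm,
    Set.Ioc_inter_Ioi, max_eq_right h0, Real.volume_Ioc]

lemma lintegral_step {w : ℝ} (h0 : 0 ≤ w) (h1 : w ≤ 1) (a b : ℝ≥0∞) :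
    ∫⁻ ω, step w a b ω ∂(uniform01 : Measure ℝ) =
      ENNReal.ofReal w * a + ENNReal.ofReal (1 - w) * b := by
  rw [← lintegral_add_compl _ (measurableSet_Iic (a := w)),
    setLIntegral_congr_fun (g := fun _ => a) measurableSet_Iic
      (fun ω (hω : ω ≤ w) => by simp [step, hω]),
    setLIntegral_congr_fun (g := fun _ => b) measurableSet_Iic.compl
      (fun ω (hω : ¬ ω ≤ w) => by simp [step, hω])]
  simp [uniform01_Iic h1, uniform01_Ioi h0, mul_comm]

lemma integrable_step (w a b : ℝ) : Integrable (step w a b) (uniform01 : Measure ℝ) :=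
  Integrable.of_bound (measurable_step w a b).aestronglyMeasurable (max |a| |b|)
    (.of_forall fun ω => by unfold step; split_ifs <;> simp)

lemma integral_step {w : ℝ} (h0 : 0 ≤ w) (h1 : w ≤ 1) (a b : ℝ) :
    ∫ ω, step w a b ω ∂(uniform01 : Measure ℝ) = w * a + (1 - w) * b := by
  rw [← integral_add_compl (measurableSet_Iic (a := w)) (integrable_step w a b),
    setIntegral_congr_fun (g := fun _ => a) measurableSet_Iic
      (fun ω (hω : ω ≤ w) => by simp [step, hω]),
    setIntegral_congr_fun (g := fun _ => b) measurableSet_Iic.compl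
      (fun ω (hω : ¬ ω ≤ w) => by simp [step, hω])]
  simp [measureReal_def, uniform01_Iic h1, uniform01_Ioi h0, h0, h1]

lemma comp_step {X Y : Type*} (h : X → Y) (w : ℝ) (a b : X) (ω : ℝ) :
    h (step w a b ω) = step w (h a) (h b) ω := by
  unfold step; split_ifs <;> rfl

lemma comp_step₂ {X Y Z : Type*} (h : X → Y → Z) (w : ℝ) (a b : X) (a' b' : Y) (ω : ℝ) :
    h (step w a b ω) (step w a' b' ω) = step w (h a a') (h b b') ω := by
  unfold step; split_ifs <;> rfl

lemma lintegral_step_ofReal {w : ℝ} (h0 : 0 ≤ w) (h1 : w ≤ 1) {a b : ℝ} (ha : 0 ≤ a)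
    (hb : 0 ≤ b) :
    ∫⁻ ω, step w (ENNReal.ofReal a) (ENNReal.ofReal b) ω ∂(uniform01 : Measure ℝ) =
      ENNReal.ofReal (w * a + (1 - w) * b) := by
  have : 0 ≤ 1 - w := by linarith
  rw [lintegral_step h0 h1, ← ENNReal.ofReal_mul h0, ← ENNReal.ofReal_mul this,
    ← ENNReal.ofReal_add (by positivity) (by positivity)]

end Step

/-! ### Expected profit and costs under two-point demand -/

section Profit

@[fun_prop]
lemma measurable_profit (p c q : ℝ) : Measurable (profit p c q) := by
  unfold profit; fun_prop

lemma abs_profit_le {p c q : ℝ} (hp : 0 ≤ p) (hq : 0 ≤ q) (u : ℝ≥0) :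
    |profit p c q u| ≤ p * q + |c * q| := by
  unfold profit
  have h1 : 0 ≤ min q (u : ℝ) := le_min hq u.2
  have h2 : p * min q (u : ℝ) ≤ p * q := mul_le_mul_of_nonneg_left (min_le_left _ _) hp
  have h3 : 0 ≤ p * min q (u : ℝ) := by positivity
  refine (abs_sub _ _).trans ?_
  rw [abs_of_nonneg h3]
  linarith

lemma integrable_profit {X : Type*} [MeasurableSpace X] {ν : Measure X} [IsFiniteMeasure ν]
    {p c q : ℝ} (hp : 0 ≤ p) (hq : 0 ≤ q) {f : X → ℝ≥0} (hf : Measurable f) :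
    Integrable (fun x => profit p c q (f x)) ν :=
  Integrable.of_bound ((measurable_profit p c q).comp hf).aestronglyMeasurable (p * q + |c * q|)
    (.of_forall fun x => abs_profit_le hp hq (f x))

lemma profit_le_left {p c q : ℝ} (hp : 0 ≤ p) (u : ℝ≥0) : profit p c q u ≤ p * u - c * q := by
  unfold profit
  have := mul_le_mul_of_nonneg_left (min_le_right q (u : ℝ)) hp
  linarith

lemma profit_le_right {p c q : ℝ} (hp : 0 ≤ p) (u : ℝ≥0) : profit p c q u ≤ p * q - c * q := by
  unfold profit
  have := mul_le_mul_of_nonneg_left (min_le_left q (u : ℝ)) hp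
  linarith

@[fun_prop]
lemma measurable_sqCost : Measurable fun z : ℝ≥0 × ℝ≥0 => sqCost z.1 z.2 := by
  unfold sqCost; fun_prop

lemma measurable_sqCostVec {M : ℕ} :
    Measurable fun z : (Fin M → ℝ≥0) × (Fin M → ℝ≥0) => sqCostVec z.1 z.2 := by
  unfold sqCostVec sqCost; fun_prop

lemma coe_sq_eq_ofReal (v : ℝ≥0) : (v : ℝ≥0∞) ^ 2 = ENNReal.ofReal ((v : ℝ) ^ 2) := by
  rw [ENNReal.ofReal_pow v.coe_nonneg, ENNReal.ofReal_coe_nnreal]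

/-- Expected profit of one product when the demand is `u` with probability `w` and `y`
otherwise. -/
lemma integral_profit_step_le {p c q w : ℝ} (hp : 0 ≤ p) (h0 : 0 ≤ w) (h1 : w ≤ 1)
    (u y : ℝ≥0) :
    ∫ ω, profit p c q (step w u y ω) ∂(uniform01 : Measure ℝ) ≤
      w * (p * u) + (1 - w) * (p * q) - c * q := by
  simp_rw [comp_step (profit p c q)]
  rw [integral_step h0 h1]
  have := mul_le_mul_of_nonneg_left (profit_le_left (c := c) (q := q) hp u) h0
  have := mul_le_mul_of_nonneg_left (profit_le_right (c := c) (q := q) hp y) (sub_nonneg.2 h1)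
  linarith

lemma lintegral_sqCost_step {w : ℝ} (h0 : 0 ≤ w) (h1 : w ≤ 1) (u x y : ℝ≥0) :
    ∫⁻ ω, sqCost (step w u y ω) (step w x y ω) ∂(uniform01 : Measure ℝ) =
      ENNReal.ofReal (w * ((u : ℝ) - x) ^ 2) := by
  simp_rw [comp_step₂ sqCost]
  unfold sqCost
  rw [lintegral_step_ofReal h0 h1 (sq_nonneg _) (sq_nonneg _)]
  simp

lemma lintegral_coe_step {w : ℝ} (h0 : 0 ≤ w) (h1 : w ≤ 1) (x y : ℝ≥0) :
    ∫⁻ ω, ((step w x y ω : ℝ≥0) : ℝ≥0∞) ∂(uniform01 : Measure ℝ) =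
      ENNReal.ofReal (w * x + (1 - w) * y) := by
  simp_rw [comp_step (fun v : ℝ≥0 => (v : ℝ≥0∞)), ← ENNReal.ofReal_coe_nnreal]
  exact lintegral_step_ofReal h0 h1 x.2 y.2

lemma lintegral_coe_sq_step {w : ℝ} (h0 : 0 ≤ w) (h1 : w ≤ 1) (x y : ℝ≥0) :
    ∫⁻ ω, ((step w x y ω : ℝ≥0) : ℝ≥0∞) ^ 2 ∂(uniform01 : Measure ℝ) =
      ENNReal.ofReal (w * (x : ℝ) ^ 2 + (1 - w) * (y : ℝ) ^ 2) := by
  simp_rw [comp_step (fun v : ℝ≥0 => (v : ℝ≥0∞) ^ 2), coe_sq_eq_ofReal]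
  rw [lintegral_step_ofReal h0 h1 (sq_nonneg _) (sq_nonneg _)]

end Profit

end Newsvendor
namespace Newsvendor

lemma integrable_of_lintegral_coe_eq {X : Type*} [MeasurableSpace X] {ν : Measure X}
    {f : X → ℝ≥0} (hf : Measurable f) {m : ℝ} (hm : 0 ≤ m)
    (h : ∫⁻ x, (f x : ℝ≥0∞) ∂ν = ENNReal.ofReal m) :
    Integrable (fun x => (f x : ℝ)) ν ∧ ∫ x, (f x : ℝ) ∂ν = m := by
  have hf' : AEMeasurable (fun x => (f x : ℝ≥0∞)) ν := by fun_prop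
  have h1 := integrable_toReal_of_lintegral_ne_top hf' (by rw [h]; exact ENNReal.ofReal_ne_top)
  have h2 := integral_toReal hf' (.of_forall fun x => ENNReal.coe_lt_top)
  rw [h, ENNReal.toReal_ofReal hm] at h2
  exact ⟨h1, h2⟩

/-! ### Value of the single-product problem -/

section Single
variable {p c μ α lam : ℝ}

/-- The two-point laws built for the price λ are tested at another price λ'. Their second moment is
the same for all q, so the bound is affine in λ'; this is the source of the supergradient. -/
lemma singleValue_le (hc : 0 < c) (hcp : c < p) (hμ : 0 ≤ μ) (hα : 0 ≤ α) (hl : 0 ≤ lam)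
    {lam' : ℝ} (hl' : 0 ≤ lam') :
    singleValue p c μ α lam' ≤
      ((worstValue p c μ α lam + lam' * worstSecondMoment p c μ α lam : ℝ) : EReal) := by
  have hp : 0 < p := hc.trans hcp
  refine iSup₂_le fun q hq => ?_
  obtain ⟨w, u, x, y, h0, h1, hmean, hsq, hval, -⟩ := exists_twoPoint hc hcp hμ hα hl hq
  have hU := measurable_step w u y
  have hV := measurable_step w x y
  refine (iInf_le _ (uniform01.map hU.aemeasurable)).trans ?_
  have hG : uniform01.map hV.aemeasurable ∈ meanSet μ := by
    change ∫⁻ v, (v : ℝ≥0∞) ∂((uniform01.map hV.aemeasurable : ProbabilityMeasure ℝ≥0) :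
      Measure ℝ≥0) = _
    rw [ProbabilityMeasure.toMeasure_map, lintegral_map (by fun_prop) hV,
      lintegral_coe_step h0 h1, hmean]
  have hS : 0 ≤ lam' * worstSecondMoment p c μ α lam :=
    mul_nonneg hl' ((sq_nonneg μ).trans (sq_le_worstSecondMoment hc hcp))
  have hT : 0 ≤ α * (w * ((u : ℝ) - x) ^ 2) := by positivity
  refine coe_add_le_coe_of_le_ofReal (add_nonneg hS hT)
    ((iInf₂_le _ hG).trans ?_) ?_
  · rw [ENNReal.ofReal_add hS hT, ENNReal.ofReal_mul hl', ENNReal.ofReal_mul hα]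
    gcongr
    · rw [ProbabilityMeasure.toMeasure_map, lintegral_map (by fun_prop) hV,
        lintegral_coe_sq_step h0 h1, hsq]
    · exact (otCost_map_le uniform01 sqCost hU hV).trans_eq (lintegral_sqCost_step h0 h1 u x y)
  · rw [ProbabilityMeasure.toMeasure_map,
      integral_map hU.aemeasurable (measurable_profit p c q).aestronglyMeasurable]
    have := integral_profit_step_le (c := c) (q := q) hp.le h0 h1 u y
    linarith

lemma singleValue_eq (hc : 0 < c) (hcp : c < p) (hμ : 0 ≤ μ) (hα : 0 ≤ α) (hl : 0 ≤ lam) :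
    singleValue p c μ α lam =
      ((worstValue p c μ α lam + lam * worstSecondMoment p c μ α lam : ℝ) : EReal) := by
  refine le_antisymm (singleValue_le hc hcp hμ hα hl hl) ?_
  have hp : 0 < p := hc.trans hcp
  obtain ⟨a, b, hab, hmin⟩ := exists_affine_minorant hc hcp hμ hα hl
  have hq := orderQuantity_nonneg hc hcp hμ hα hl
  refine le_trans ?_ (le_iSup₂ (orderQuantity p c μ α lam) hq)
  refine le_iInf fun F => coe_le_coe_add_of_ofReal_sub_le (le_iInf₂ fun G hG => ?_)
  obtain ⟨hi, hm⟩ := integrable_of_lintegral_coe_eq measurable_id hμ hG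
  simp only [id] at hi hm
  have hℓ : Integrable (fun t : ℝ≥0 => a + b * (t : ℝ)) (G : Measure ℝ≥0) :=
    (integrable_const a).add (hi.const_mul b)
  have key := ofReal_integral_sub_integral_le (cost := sqCost) measurable_sqCost
    (g := fun v => (v : ℝ≥0∞) ^ 2) (by fun_prop) (F := F) (G := G) (a := ENNReal.ofReal α)
    ENNReal.ofReal_ne_top (b := ENNReal.ofReal lam)
    (f := profit p c (orderQuantity p c μ α lam)) (ℓ := fun t => a + b * (t : ℝ))
    (integrable_profit hp.le hq measurable_id) hℓ ?_
  · rwa [integral_add (integrable_const a) (hi.const_mul b), integral_const_mul, hm,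
      integral_const, probReal_univ, one_smul, hab] at key
  · intro s t
    rw [coe_sq_eq_ofReal, sqCost, ← ENNReal.ofReal_mul hα, ← ENNReal.ofReal_mul hl,
      ← ENNReal.ofReal_add (by positivity) (by positivity)]
    exact ENNReal.ofReal_le_ofReal (by linarith [hmin s t])

end Single

/-! ### Bounds on the multi-product criterion -/

section Multi
variable {M : ℕ} {p c μ : Fin M → ℝ} {K α lam : ℝ}

/-- Two-point demands coupled through one uniform random variable. -/
lemma criterion_le (hp : ∀ i, 0 ≤ p i) (hα : 0 ≤ α) {q w : Fin M → ℝ}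
    (hq : ∀ i, 0 ≤ q i) {u x y : Fin M → ℝ≥0} (h0 : ∀ i, 0 ≤ w i) (h1 : ∀ i, w i ≤ 1)
    (hmean : ∀ i, w i * x i + (1 - w i) * y i = μ i)
    (hsq : ∑ i, (w i * (x i : ℝ) ^ 2 + (1 - w i) * (y i : ℝ) ^ 2) ≤ K) :
    (ambiguitySet μ K).Nonempty ∧ criterion p c μ K α q ≤
      ((∑ i, (w i * (p i * u i + α * ((u i : ℝ) - x i) ^ 2) + (1 - w i) * (p i * q i)
        - c i * q i) : ℝ) : EReal) := by
  have hU : Measurable fun ω i => step (w i) (u i) (y i) ω :=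
    measurable_pi_lambda _ fun i => measurable_step _ _ _
  have hV : Measurable fun ω i => step (w i) (x i) (y i) ω :=
    measurable_pi_lambda _ fun i => measurable_step _ _ _
  have h1' : ∀ i, 0 ≤ 1 - w i := fun i => sub_nonneg.2 (h1 i)
  have hG : uniform01.map hV.aemeasurable ∈ ambiguitySet μ K := by
    constructor
    · intro i
      rw [ProbabilityMeasure.toMeasure_map, lintegral_map (by fun_prop) hV,
        lintegral_coe_step (h0 i) (h1 i), hmean]
    · rw [ProbabilityMeasure.toMeasure_map, lintegral_map (by fun_prop) hV,
        lintegral_finsetSum _ (fun i _ => by fun_prop)]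
      simp_rw [fun i => lintegral_coe_sq_step (h0 i) (h1 i) (x i) (y i)]
      rw [← ENNReal.ofReal_sum_of_nonneg]
      · exact ENNReal.ofReal_le_ofReal hsq
      · intro i _
        have := h0 i
        have := h1' i
        positivity
  refine ⟨⟨_, hG⟩, (iInf_le _ (uniform01.map hU.aemeasurable)).trans ?_⟩
  have hT : ∀ i, 0 ≤ w i * ((u i : ℝ) - x i) ^ 2 := fun i => mul_nonneg (h0 i) (sq_nonneg _)
  refine coe_add_le_coe_of_le_ofReal (E := α * ∑ i, w i * ((u i : ℝ) - x i) ^ 2)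
    (mul_nonneg hα (Finset.sum_nonneg fun i _ => hT i)) ?_ ?_
  · rw [ENNReal.ofReal_mul hα]
    gcongr
    refine (iInf₂_le _ hG).trans ((otCost_map_le uniform01 sqCostVec hU hV).trans ?_)
    unfold sqCostVec
    rw [lintegral_finsetSum _ (fun i _ => by unfold sqCost; fun_prop),
      ENNReal.ofReal_sum_of_nonneg fun i _ => hT i]
    exact Finset.sum_le_sum fun i _ => (lintegral_sqCost_step (h0 i) (h1 i) _ _ _).le
  · rw [ProbabilityMeasure.toMeasure_map, integral_map hU.aemeasurable
      (Measurable.aestronglyMeasurable (by fun_prop)),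
      integral_finsetSum _ fun i _ => integrable_profit (hp i) (hq i) (measurable_step _ _ _),
      Finset.mul_sum, ← Finset.sum_add_distrib]
    refine Finset.sum_le_sum fun i _ => ?_
    have := integral_profit_step_le (c := c i) (q := q i) (hp i) (h0 i) (h1 i) (u i) (y i)
    linarith

/-- Weak duality: cost and moment constraint are separable, so the affine minorants of the products
add up, and λ times the second moment is at most λK on the ambiguity set. Nonemptiness matters for α
= 0, where 0 · ∞ = 0 would hide an empty set. -/
lemma le_criterion_orderQuantity (hc : ∀ i, 0 < c i) (hcp : ∀ i, c i < p i) (hμ : ∀ i, 0 ≤ μ i)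
    (hK : 0 ≤ K) (hα : 0 ≤ α) (hl : 0 ≤ lam) (hne : (ambiguitySet μ K).Nonempty) :
    ((-(lam * K) + ∑ i, (worstValue (p i) (c i) (μ i) α lam +
        lam * worstSecondMoment (p i) (c i) (μ i) α lam) : ℝ) : EReal) ≤
      criterion p c μ K α fun i => orderQuantity (p i) (c i) (μ i) α lam := by
  have hp : ∀ i, 0 < p i := fun i => (hc i).trans (hcp i)
  choose a b hab hmin using fun i => exists_affine_minorant (hc i) (hcp i) (hμ i) hα hl
  have hq := fun i => orderQuantity_nonneg (hc i) (hcp i) (hμ i) hα hl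
  set q := fun i => orderQuantity (p i) (c i) (μ i) α lam with hqd
  refine le_iInf fun F => coe_le_coe_add_of_ofReal_sub_le ?_
  have key : ∀ G ∈ ambiguitySet μ K, ENNReal.ofReal (-(lam * K) + ∑ i,
      (worstValue (p i) (c i) (μ i) α lam + lam * worstSecondMoment (p i) (c i) (μ i) α lam) -
      ∫ u, ∑ i, profit (p i) (c i) (q i) (u i) ∂(F : Measure (Fin M → ℝ≥0))) ≤
      ENNReal.ofReal α * otCost sqCostVec F G := by
    intro G hG
    have hi := fun i => integrable_of_lintegral_coe_eq (measurable_pi_apply i) (hμ i) (hG.1 i)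
    have hℓi : ∀ i, Integrable (fun t : Fin M → ℝ≥0 => a i + b i * (t i : ℝ))
        (G : Measure (Fin M → ℝ≥0)) :=
      fun i => (integrable_const (a i)).add ((hi i).1.const_mul (b i))
    have h := ofReal_integral_sub_integral_le (cost := sqCostVec) measurable_sqCostVec
      (g := fun v : Fin M → ℝ≥0 => ∑ i, (v i : ℝ≥0∞) ^ 2) (by fun_prop) (F := F) (G := G)
      (a := ENNReal.ofReal α) ENNReal.ofReal_ne_top (b := ENNReal.ofReal lam)
      (f := fun u => ∑ i, profit (p i) (c i) (q i) (u i))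
      (ℓ := fun t => ∑ i, (a i + b i * (t i : ℝ)))
      (integrable_finsetSum _ fun i _ =>
        integrable_profit (hp i).le (hq i) (measurable_pi_apply i))
      (integrable_finsetSum _ fun i _ => hℓi i) ?_
    · rw [integral_finsetSum _ fun i _ => hℓi i, Finset.sum_congr rfl fun i _ =>
        (show ∫ t : Fin M → ℝ≥0, (a i + b i * (t i : ℝ)) ∂(G : Measure (Fin M → ℝ≥0)) = _ by
          rw [integral_add (integrable_const (a i)) ((hi i).1.const_mul (b i)),
            integral_const_mul, (hi i).2, integral_const, probReal_univ, one_smul, hab i])] at h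
      have h2 := h.trans (add_le_add_left (mul_le_mul_right hG.2 _) _)
      rw [add_comm, ← tsub_le_iff_right, ← ENNReal.ofReal_mul hl,
        ← ENNReal.ofReal_sub _ (mul_nonneg hl hK)] at h2
      refine le_of_eq_of_le ?_ h2
      congr 1
      ring
    · intro s t
      unfold sqCostVec sqCost
      simp_rw [coe_sq_eq_ofReal]
      rw [← ENNReal.ofReal_sum_of_nonneg fun i _ => sq_nonneg _,
        ← ENNReal.ofReal_sum_of_nonneg fun i _ => sq_nonneg _, ← ENNReal.ofReal_mul hα,
        ← ENNReal.ofReal_mul hl, ← ENNReal.ofReal_add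
        (mul_nonneg hα (Finset.sum_nonneg fun i _ => sq_nonneg _))
        (mul_nonneg hl (Finset.sum_nonneg fun i _ => sq_nonneg _))]
      refine ENNReal.ofReal_le_ofReal ?_
      rw [Finset.mul_sum, Finset.mul_sum, ← Finset.sum_sub_distrib, ← Finset.sum_add_distrib]
      exact Finset.sum_le_sum fun i _ => by linarith [hmin i (s i) (t i)]
  rcases eq_or_ne (ENNReal.ofReal α) 0 with h | h
  · obtain ⟨G, hG⟩ := hne
    have := key G hG
    rw [h, zero_mul] at this ⊢
    exact this
  · unfold distToSet
    rw [mul_comm (ENNReal.ofReal α)]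
    refine (ENNReal.div_le_iff_le_mul (.inl h) (.inl ENNReal.ofReal_ne_top)).1 ?_
    exact le_iInf₂ fun G hG => ENNReal.div_le_of_le_mul' (key G hG)

/-! ### The dual problem -/

/-- Real value of the dual objective. -/
noncomputable def dualValue (p c μ : Fin M → ℝ) (K α lam : ℝ) : ℝ :=
  -(lam * K) + ∑ i, (worstValue (p i) (c i) (μ i) α lam +
    lam * worstSecondMoment (p i) (c i) (μ i) α lam)

/-- Sum of the worst-case second moments. -/
noncomputable def totalMoment (p c μ : Fin M → ℝ) (α lam : ℝ) : ℝ :=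
  ∑ i, worstSecondMoment (p i) (c i) (μ i) α lam

lemma coe_sum (f : Fin M → ℝ) : ((∑ i, f i : ℝ) : EReal) = ∑ i, (f i : EReal) := by
  induction (Finset.univ : Finset (Fin M)) using Finset.induction_on with
  | empty => simp
  | insert i s hi ih => rw [Finset.sum_insert hi, Finset.sum_insert hi, EReal.coe_add, ih]

lemma dualObjective_eq (hc : ∀ i, 0 < c i) (hcp : ∀ i, c i < p i) (hμ : ∀ i, 0 ≤ μ i)
    (hα : 0 ≤ α) (hl : 0 ≤ lam) :
    dualObjective p c μ K α lam = (dualValue p c μ K α lam : EReal) := by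
  rw [dualObjective, dualValue, EReal.coe_add, coe_sum]
  exact congrArg _ (Finset.sum_congr rfl fun i _ => singleValue_eq (hc i) (hcp i) (hμ i) hα hl)

/-- Supergradient inequality of the dual objective. -/
lemma dualValue_le (hc : ∀ i, 0 < c i) (hcp : ∀ i, c i < p i) (hμ : ∀ i, 0 ≤ μ i)
    (hα : 0 ≤ α) (hl : 0 ≤ lam) {lam' : ℝ} (hl' : 0 ≤ lam') :
    dualValue p c μ K α lam' ≤
      dualValue p c μ K α lam + (lam' - lam) * (totalMoment p c μ α lam - K) := by
  have h : ∀ i, worstValue (p i) (c i) (μ i) α lam' +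
      lam' * worstSecondMoment (p i) (c i) (μ i) α lam' ≤
      worstValue (p i) (c i) (μ i) α lam + lam' * worstSecondMoment (p i) (c i) (μ i) α lam := by
    intro i
    have := singleValue_le (hc i) (hcp i) (hμ i) hα hl hl'
    rw [singleValue_eq (hc i) (hcp i) (hμ i) hα hl'] at this
    exact_mod_cast this
  have h2 := Finset.sum_le_sum fun i (_ : i ∈ Finset.univ) => h i
  unfold dualValue totalMoment
  rw [Finset.sum_add_distrib, ← Finset.mul_sum] at h2 ⊢
  rw [Finset.sum_add_distrib, ← Finset.mul_sum] at h2 ⊢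
  linarith

lemma continuousOn_totalMoment (hc : ∀ i, 0 < c i) (hcp : ∀ i, c i < p i) (hα : 0 ≤ α) :
    ContinuousOn (totalMoment p c μ α) (Set.Ici 0) := by
  unfold totalMoment
  exact continuousOn_finsetSum _ fun i _ =>
    continuousOn_worstSecondMoment (hc i) (hcp i) hα

lemma isDualOptimal_iff_dualValue (hc : ∀ i, 0 < c i) (hcp : ∀ i, c i < p i)
    (hμ : ∀ i, 0 ≤ μ i) (hα : 0 ≤ α) :
    IsDualOptimal p c μ K α lam ↔
      0 ≤ lam ∧ ∀ lam', 0 ≤ lam' → dualValue p c μ K α lam' ≤ dualValue p c μ K α lam := by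
  refine and_congr_right fun hl => forall₂_congr fun lam' hl' => ?_
  rw [dualObjective_eq hc hcp hμ hα hl, dualObjective_eq hc hcp hμ hα hl', EReal.coe_le_coe_iff]

open Filter Topology in
/-- Feasibility and complementary slackness characterize the optimal dual variable. -/
lemma isDualOptimal_iff (hc : ∀ i, 0 < c i) (hcp : ∀ i, c i < p i) (hμ : ∀ i, 0 ≤ μ i)
    (hα : 0 ≤ α) :
    IsDualOptimal p c μ K α lam ↔
      0 ≤ lam ∧ totalMoment p c μ α lam ≤ K ∧ (0 < lam → totalMoment p c μ α lam = K) := by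
  rw [isDualOptimal_iff_dualValue hc hcp hμ hα]
  refine and_congr_right fun hl => ⟨fun h => ?_, fun ⟨h1, h2⟩ lam' hl' => ?_⟩
  · have hcont : ContinuousWithinAt (totalMoment p c μ α) (Set.Ici 0) lam :=
      continuousOn_totalMoment hc hcp hα lam hl
    have hle : totalMoment p c μ α lam ≤ K := by
      have ht : Tendsto (totalMoment p c μ α) (𝓝[>] lam) (𝓝 (totalMoment p c μ α lam)) :=
        hcont.mono_left (nhdsWithin_mono _ fun z (hz : lam < z) => hl.trans hz.le)
      refine le_of_tendsto ht ?_
      filter_upwards [self_mem_nhdsWithin] with z (hz : lam < z)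
      -- The supergradient inequality is based at the neighbour z, not at λ: with optimality of λ it
      -- gives (λ - z)(∑S(z) - K) ≥ 0. The sign is then passed to the limit z → λ.
      have h1 := dualValue_le (K := K) hc hcp hμ hα (hl.trans hz.le) hl
      have h2 := h z (hl.trans hz.le)
      nlinarith
    refine ⟨hle, fun hpos => le_antisymm hle ?_⟩
    have ht : Tendsto (totalMoment p c μ α) (𝓝[<] lam) (𝓝 (totalMoment p c μ α lam)) :=
      (hcont.continuousAt (Ici_mem_nhds hpos)).tendsto.mono_left nhdsWithin_le_nhds
    refine ge_of_tendsto ht ?_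
    filter_upwards [self_mem_nhdsWithin, mem_nhdsWithin_of_mem_nhds (Ici_mem_nhds hpos)]
      with z (hz : z < lam) (hz0 : 0 ≤ z)
    have h1 := dualValue_le (K := K) hc hcp hμ hα hz0 hl
    have h2 := h z hz0
    nlinarith
  · have h3 := dualValue_le (K := K) hc hcp hμ hα hl hl'
    rcases hl.eq_or_lt with h0 | h0
    · subst h0
      nlinarith
    · rw [h2 h0] at h3
      linarith

open Filter Topology in
lemma exists_isDualOptimal (hc : ∀ i, 0 < c i) (hcp : ∀ i, c i < p i) (hμ : ∀ i, 0 ≤ μ i)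
    (hα : 0 ≤ α) (hK : ∑ i, μ i ^ 2 < K) : ∃ lam, IsDualOptimal p c μ K α lam := by
  simp_rw [isDualOptimal_iff hc hcp hμ hα]
  rcases le_or_gt (totalMoment p c μ α 0) K with h | h
  · exact ⟨0, le_rfl, h, fun h => absurd h (lt_irrefl _)⟩
  have ht : Tendsto (totalMoment p c μ α) atTop (𝓝 (∑ i, μ i ^ 2)) :=
    tendsto_finsetSum _ fun i _ => tendsto_worstSecondMoment (hc i) (hcp i)
  obtain ⟨b, hb, hb0⟩ := ((ht.eventually_lt_const hK).and (eventually_ge_atTop 0)).exists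
  obtain ⟨lam, hlam, he⟩ := intermediate_value_Icc' hb0
    ((continuousOn_totalMoment hc hcp hα).mono Set.Icc_subset_Ici_self) ⟨hb.le, h.le⟩
  exact ⟨lam, hlam.1, he.le, fun _ => he⟩

lemma not_isDualOptimal_of_lt (hc : ∀ i, 0 < c i) (hcp : ∀ i, c i < p i) (hμ : ∀ i, 0 ≤ μ i)
    (hα : 0 ≤ α) (hK : ∑ i, μ i ^ 2 < K) {lam' : ℝ} (h : IsDualOptimal p c μ K α lam)
    (hlt : lam < lam') : ¬ IsDualOptimal p c μ K α lam' := by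
  rw [isDualOptimal_iff hc hcp hμ hα] at h ⊢
  rintro ⟨-, -, h'⟩
  have he := h' (h.1.trans_lt hlt)
  rw [← he, totalMoment] at hK
  -- Since ∑S(λ') = K > ∑μᵢ², some product has S above μᵢ², so αμᵢ ≠ 0 and its S is strictly
  -- decreasing; thus ∑S(λ) > K.
  obtain ⟨i, -, hi⟩ := Finset.exists_lt_of_sum_lt hK
  have : totalMoment p c μ α lam' < totalMoment p c μ α lam :=
    Finset.sum_lt_sum
      (fun j _ => worstSecondMoment_anti (hc j) (hcp j) (hμ j) hα h.1 hlt)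
      ⟨i, Finset.mem_univ i, worstSecondMoment_lt (hc i) (hcp i) (hμ i) hα
        (fun h0 => hi.ne' (worstSecondMoment_eq_sq h0)) h.1 hlt⟩
  linarith [h.2.1]

lemma existsUnique_isDualOptimal (hc : ∀ i, 0 < c i) (hcp : ∀ i, c i < p i) (hμ : ∀ i, 0 ≤ μ i)
    (hα : 0 ≤ α) (hK : ∑ i, μ i ^ 2 < K) : ∃! lam, IsDualOptimal p c μ K α lam := by
  obtain ⟨lam, h⟩ := exists_isDualOptimal hc hcp hμ hα hK
  refine ⟨lam, h, fun lam' h' => ?_⟩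
  rcases lt_trichotomy lam' lam with hlt | heq | hlt
  · exact absurd h (not_isDualOptimal_of_lt hc hcp hμ hα hK h' hlt)
  · exact heq
  · exact absurd h' (not_isDualOptimal_of_lt hc hcp hμ hα hK h hlt)

/-! ### Saddle point and uniqueness of the order -/

lemma isOptimalOrder_iff (hc : ∀ i, 0 < c i) (hcp : ∀ i, c i < p i) (hμ : ∀ i, 0 ≤ μ i)
    (hK : 0 ≤ K) (hα : 0 ≤ α) (h : IsDualOptimal p c μ K α lam) (q : Fin M → ℝ) :
    IsOptimalOrder p c μ K α q ↔ ∀ i, q i = orderQuantity (p i) (c i) (μ i) α lam := by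
  rw [isDualOptimal_iff hc hcp hμ hα] at h
  obtain ⟨hl, hle, hslack⟩ := h
  set q₀ := fun i => orderQuantity (p i) (c i) (μ i) α lam with hq₀d
  have hq₀ : ∀ i, 0 ≤ q₀ i := fun i => orderQuantity_nonneg (hc i) (hcp i) (hμ i) hα hl
  set V := ∑ i, worstValue (p i) (c i) (μ i) α lam with hV
  have upper : ∀ q : Fin M → ℝ, (∀ i, 0 ≤ q i) → (ambiguitySet μ K).Nonempty ∧
      criterion p c μ K α q ≤ (V : EReal) ∧ (q ≠ q₀ → criterion p c μ K α q < (V : EReal)) := by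
    intro q hq
    choose w u x y h0 h1 hmean hsq hval hlt using
      fun i => exists_twoPoint (hc i) (hcp i) (hμ i) hα hl (hq i)
    obtain ⟨hne, hcrit⟩ := criterion_le (c := c) (K := K) (fun i => ((hc i).trans (hcp i)).le) hα hq
      (u := u) h0 h1 hmean (by rw [Finset.sum_congr rfl fun i _ => hsq i]; exact hle)
    refine ⟨hne, hcrit.trans ?_, fun hqq => hcrit.trans_lt ?_⟩
    · exact EReal.coe_le_coe_iff.2 (Finset.sum_le_sum fun i _ => hval i)
    · obtain ⟨i, hi⟩ := Function.ne_iff.1 hqq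
      exact EReal.coe_lt_coe_iff.2 (Finset.sum_lt_sum (fun i _ => hval i)
        ⟨i, Finset.mem_univ i, hlt i hi⟩)
  have lower : (V : EReal) ≤ criterion p c μ K α q₀ := by
    refine le_of_eq_of_le ?_ (le_criterion_orderQuantity hc hcp hμ hK hα hl (upper q₀ hq₀).1)
    rw [Finset.sum_add_distrib, ← Finset.mul_sum]
    congr 1
    change V = -(lam * K) + (V + lam * totalMoment p c μ α lam)
    -- Complementary slackness: λ(∑S(λ) - K) = 0.
    rcases hl.eq_or_lt with h0 | h0
    · rw [← h0]; ring
    · rw [hslack h0]; ring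
  rw [← funext_iff (f := q) (g := q₀)]
  constructor
  · rintro ⟨hq, hopt⟩
    by_contra hne
    exact absurd (lower.trans (hopt q₀ hq₀)) (not_le.2 ((upper q hq).2.2 hne))
  · rintro rfl
    exact ⟨hq₀, fun q' hq' => (upper q' hq').2.1.trans lower⟩

end Multi

end Newsvendor

theorem theorem5 {M : ℕ} (p c μ : Fin M → ℝ) (K α : ℝ)
    (hc : ∀ i, 0 < c i) (hcp : ∀ i, c i < p i) (hμ : ∀ i, 0 ≤ μ i)
    (hK : 0 ≤ K) (hα : 0 ≤ α) :
    (∑ i, μ i ^ 2 < K → ∃! lam : ℝ, Newsvendor.IsDualOptimal p c μ K α lam) ∧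
    ∀ lam : ℝ, Newsvendor.IsDualOptimal p c μ K α lam →
      ∀ q : Fin M → ℝ, Newsvendor.IsOptimalOrder p c μ K α q ↔
        ∀ i, q i = Newsvendor.orderQuantity (p i) (c i) (μ i) α lam :=
  ⟨Newsvendor.existsUnique_isDualOptimal hc hcp hμ hα, fun _ h q =>
    Newsvendor.isOptimalOrder_iff hc hcp hμ hK hα h q⟩
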